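/- For $n\ge 1$ let $B_n$ be the Artin braid group, with generators $\sigma_1,\dots,\sigma_{n-1}$ and relations $\sigma_i\sigma_j=\sigma_j\sigma_i$ for $|i-j|>1$ and $\sigma_i\sigma_{i+1}\sigma_i=\sigma_{i+1}\sigma_i\sigma_{i+1}$; let $K_n=\mathrm{Ker}(B_n\to S_n,\ \sigma_i\mapsto(i,i+1))$ be the pure braid group, and let $P_5^*=K_4/Z(B_4)$ be the pure modular group of the sphere with $5$ marked points, where $Z(B_4)\subset K_4$ is the center of $B_4$. For $1\le i<j\le 4$ set $$\tilde x_{ij}=(\sigma_{j-1}\cdots\sigma_{i+1})\,\sigma_i^2\,(\sigma_{j-1}\cdots\sigma_{i+1})^{-1}\in K_4,$$ for $1\le i\le 4$ set $$\tilde x_{i5}=(\tilde x_{1i}\cdots\tilde x_{i-1,i}\,\tilde x_{i,i+1}\cdots\tilde x_{i4})^{-1}\in K_4,$$ and for $1\le i<j\le5$ let $x_{ij}\in P_5^*$ be the class of $\tilde x_{ij}$. For $i\in\mathbb Z/5$ define $g_i\in P_5^*$ by $g_i=x_{i,i+1}$ for $i=1,2,3,4$ and $g_0=x_{15}$. Write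 $(g,h)=ghg^{-1}h^{-1}$. Then the group $P_5^*$ is presented by the generators $g_i$ ($i\in\mathbb Z/5$), subject to the relations $$(g_i,g_j)=1\quad\text{for } i,j\in\mathbb Z/5 \text{ with } i-j\ne\pm1,$$ $$(g_0,g_1)(g_1,g_2)(g_2,g_3)(g_3,g_4)(g_4,g_0)=1.$$ -/

import Mathlib

/-- Artin's relations between the generators `σ_i`, `1 ≤ i < n`, of the braid group on `n` strands. -/
def braidRelations (n : ℕ) : Set (FreeGroup {i : ℕ // 1 ≤ i ∧ i < n}) :=
  {r | ∃ i j : {i : ℕ // 1 ≤ i ∧ i < n}, i.1 + 1 < j.1 ∧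
      r = FreeGroup.of i * FreeGroup.of j * (FreeGroup.of j * FreeGroup.of i)⁻¹} ∪
  {r | ∃ i j : {i : ℕ // 1 ≤ i ∧ i < n}, i.1 + 1 = j.1 ∧
      r = FreeGroup.of i * FreeGroup.of j * FreeGroup.of i *
        (FreeGroup.of j * FreeGroup.of i * FreeGroup.of j)⁻¹}

/-- The Artin braid group `B_n`. -/
abbrev BraidGroup (n : ℕ) : Type := PresentedGroup (braidRelations n)

namespace BraidGroup

/-- The generator `σ_i ∈ B_n`, for `1 ≤ i < n` (and the junk value `1` for other `i`). -/
def sigma (n i : ℕ) : BraidGroup n :=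
  if h : 1 ≤ i ∧ i < n then PresentedGroup.of ⟨i, h⟩ else 1

/-- The transposition of the `i`-th and the `(i+1)`-st element of `Fin n`, `1 ≤ i < n`. -/
def adjSwap (n : ℕ) (i : {i : ℕ // 1 ≤ i ∧ i < n}) : Equiv.Perm (Fin n) :=
  Equiv.swap ⟨i.1 - 1, by omega⟩ ⟨i.1, i.2.2⟩

theorem swap_braid {α : Type*} [DecidableEq α] {a b c : α} (hab : a ≠ b) (hac : a ≠ c)
    (hbc : b ≠ c) :
    Equiv.swap a b * Equiv.swap b c * Equiv.swap a b =
      Equiv.swap b c * Equiv.swap a b * Equiv.swap b c := by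
  rw [Equiv.swap_mul_swap_mul_swap hab hac, Equiv.swap_comm a b, Equiv.swap_comm b c,
    Equiv.swap_mul_swap_mul_swap hbc.symm hac.symm, Equiv.swap_comm]

theorem adjSwap_relations (n : ℕ) :
    ∀ r ∈ braidRelations n, FreeGroup.lift (adjSwap n) r = 1 := by
  rintro r (⟨⟨i, hi⟩, ⟨j, hj⟩, hij, rfl⟩ | ⟨⟨i, hi⟩, ⟨j, hj⟩, hij, rfl⟩)
  · simp only [map_mul, map_inv, FreeGroup.lift_apply_of, mul_inv_eq_one]
    simp only at hij
    refine (Equiv.Perm.disjoint_iff_disjoint_support.mpr ?_).commute.eq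
    rw [adjSwap, adjSwap, Equiv.Perm.support_swap, Equiv.Perm.support_swap]
    · simp [Fin.ext_iff]; omega
    all_goals simp [Fin.ext_iff]; omega
  · simp only [map_mul, map_inv, FreeGroup.lift_apply_of, mul_inv_eq_one]
    simp only at hij
    subst hij
    have h1 : (⟨i - 1, by omega⟩ : Fin n) ≠ ⟨i, hi.2⟩ := by simp [Fin.ext_iff]; omega
    have h2 : (⟨i - 1, by omega⟩ : Fin n) ≠ ⟨i + 1, hj.2⟩ := by simp [Fin.ext_iff]
    have h3 : (⟨i, hi.2⟩ : Fin n) ≠ ⟨i + 1, hj.2⟩ := by simp [Fin.ext_iff]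
    simp only [adjSwap, Nat.add_sub_cancel]
    exact swap_braid h1 h2 h3

/-- The morphism `B_n → S_n`, `σ_i ↦ (i, i+1)`. -/
def toPerm (n : ℕ) : BraidGroup n →* Equiv.Perm (Fin n) :=
  PresentedGroup.toGroup (adjSwap_relations n)

theorem toPerm_sigma_sq (n i : ℕ) : toPerm n (sigma n i ^ 2) = 1 := by
  unfold sigma
  split_ifs with h
  · simp [toPerm, adjSwap, pow_two]
  · simp

end BraidGroup

/-- The pure Artin braid group `K_n = Ker(B_n → S_n)`. -/
abbrev PureBraidGroup (n : ℕ) : Subgroup (BraidGroup n) := (BraidGroup.toPerm n).ker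

namespace PureBraidGroup

/-- `σ_{j-1} σ_{j-2} ⋯ σ_{i+1} ∈ B_n`. -/
def ladder (n i j : ℕ) : BraidGroup n :=
  (((List.Ico (i + 1) j).reverse).map (BraidGroup.sigma n)).prod

/-- `x̃_{ij} = (σ_{j-1} ⋯ σ_{i+1}) σ_i² (σ_{j-1} ⋯ σ_{i+1})⁻¹ ∈ K_n`, for `1 ≤ i < j ≤ n`. -/
def xInner (n i j : ℕ) : PureBraidGroup n :=
  ⟨ladder n i j * BraidGroup.sigma n i ^ 2 * (ladder n i j)⁻¹, by
    rw [MonoidHom.mem_ker, map_mul, map_mul, BraidGroup.toPerm_sigma_sq, map_inv, mul_one,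
      mul_inv_cancel]⟩

/-- `x̃_{i,n+1} = (x̃_{1i} ⋯ x̃_{i-1,i} x̃_{i,i+1} ⋯ x̃_{in})⁻¹ ∈ K_n`, for `1 ≤ i ≤ n`. -/
def xLast (n i : ℕ) : PureBraidGroup n :=
  (((List.Ico 1 i).map fun k => xInner n k i).prod *
    ((List.Ico (i + 1) (n + 1)).map fun k => xInner n i k).prod)⁻¹

/-- The elements `x̃_{ij} ∈ K_n`, for `1 ≤ i < j ≤ n + 1`. -/
def xTilde (n i j : ℕ) : PureBraidGroup n :=
  if j ≤ n then xInner n i j else xLast n i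

end PureBraidGroup

/-- `PureModularGroupSucc n` is `P_{n+1}^* = K_n / Z(B_n)` (`n ≥ 2`), the pure modular group of the
sphere with `n + 1` marked points. -/
abbrev PureModularGroupSucc (n : ℕ) : Type :=
  PureBraidGroup n ⧸ (Subgroup.center (BraidGroup n)).subgroupOf (PureBraidGroup n)

/-- The elements `x_{ij} ∈ P_{n+1}^*`, for `1 ≤ i < j ≤ n + 1`. -/
def PureModularGroupSucc.x (n i j : ℕ) : PureModularGroupSucc n :=
  QuotientGroup.mk (PureBraidGroup.xTilde n i j)

/-- The elements `g_i = x_{i,i+1} ∈ P_5^*`, `i ∈ ℤ/5`, with `g_0 = x_{15}`. -/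
def pentagonGenerator (i : ZMod 5) : PureModularGroupSucc 4 :=
  if i = 0 then PureModularGroupSucc.x 4 1 5 else PureModularGroupSucc.x 4 i.val (i.val + 1)

/-- The commutator `(g_i, g_j) = g_i g_j g_i⁻¹ g_j⁻¹` in the free group on the symbols `g_i`,
`i ∈ ℤ/5`. -/
def pentagonCommutator (i j : ZMod 5) : FreeGroup (ZMod 5) :=
  FreeGroup.of i * FreeGroup.of j * (FreeGroup.of i)⁻¹ * (FreeGroup.of j)⁻¹

/-- The relations `(g_i, g_j) = 1` for `i - j ≠ ±1`, and
`(g_0, g_1) (g_1, g_2) (g_2, g_3) (g_3, g_4) (g_4, g_0) = 1`. -/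
def pentagonRelations : Set (FreeGroup (ZMod 5)) :=
  {r | ∃ i j : ZMod 5, i - j ≠ 1 ∧ i - j ≠ -1 ∧ r = pentagonCommutator i j} ∪
  {pentagonCommutator 0 1 * pentagonCommutator 1 2 * pentagonCommutator 2 3 *
    pentagonCommutator 3 4 * pentagonCommutator 4 0}

/-! Let Γ be the abstract group `PentagonGroup`. Each side i of the pentagon carries a half twist,
an automorphism t_i of Γ whose square is conjugation by `gen i`, and t_1, t_2, t_3 satisfy Artin's
relations. Thus B_4 acts on Γ, and the representative of g_i in K_4 acts as conjugation by `gen i`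
(`twistAction_pentagonGen`). Moreover Γ is a semidirect product of free groups of ranks 3 and 2, so
its centre is trivial; hence Z(B_4) acts trivially and the action descends to P_5^*.

Conversely, the g_i satisfy the pentagon relations in B_4/Z(B_4) because the square of Garside's
braid is central. This gives Γ → P_5^*. Its composite with P_5^* → Aut Γ is the conjugation map,
which is injective as Γ has no centre.

For surjectivity, conjugation by σ_i transforms the g_j by the same formulas as t_i, so the preimage
N in B_4 of the image of Γ is normal. It contains every σ_i², and Artin's relations together with
σ_i² = 1 leave at most 24 elements, so K_4 ≤ N (`ker_toPerm_le`). No presentation of K_4 is needed.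
-/

/-! ### The pentagon relation as a commutation relation. -/

/-- The product `(g₀, g₁) (g₁, g₂) (g₂, g₃) (g₃, g₄) (g₄, g₀)` of commutators. -/
def pentagonProduct {H : Type*} [Group H] (g₀ g₁ g₂ g₃ g₄ : H) : H :=
  (g₀ * g₁ * g₀⁻¹ * g₁⁻¹) * (g₁ * g₂ * g₁⁻¹ * g₂⁻¹) * (g₂ * g₃ * g₂⁻¹ * g₃⁻¹) *
    (g₃ * g₄ * g₃⁻¹ * g₄⁻¹) * (g₄ * g₀ * g₄⁻¹ * g₀⁻¹)

theorem pentagonProduct_rotate {H : Type*} [Group H] {g₀ g₁ g₂ g₃ g₄ : H}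
    (h : pentagonProduct g₀ g₁ g₂ g₃ g₄ = 1) : pentagonProduct g₁ g₂ g₃ g₄ g₀ = 1 := by
  have e : pentagonProduct g₁ g₂ g₃ g₄ g₀ = (g₀ * g₁ * g₀⁻¹ * g₁⁻¹)⁻¹ *
      pentagonProduct g₀ g₁ g₂ g₃ g₄ * (g₀ * g₁ * g₀⁻¹ * g₁⁻¹) := by
    simp only [pentagonProduct]; group
  rw [e, h]; group

theorem pentagonProduct_eq_one_iff_conj {H : Type*} [Group H] {g₀ g₁ g₂ g₃ g₄ : H}
    (h02 : Commute g₀ g₂) (h13 : Commute g₁ g₃) :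
    pentagonProduct g₀ g₁ g₂ g₃ g₄ = 1 ↔
      g₁ * g₂ * (g₀⁻¹ * g₃) * (g₂ * g₁)⁻¹ = g₄ * (g₀⁻¹ * g₃) * g₄⁻¹ := by
  have e1 : pentagonProduct g₀ g₁ g₂ g₃ g₄ =
      g₀ * (g₁ * (g₀⁻¹ * g₂) * (g₁⁻¹ * g₃) * g₂⁻¹ * (g₄ * (g₃⁻¹ * g₀) * g₄⁻¹)) * g₀⁻¹ := by
    simp only [pentagonProduct]; group
  have e2 : g₁ * (g₀⁻¹ * g₂) * (g₁⁻¹ * g₃) * g₂⁻¹ * (g₄ * (g₃⁻¹ * g₀) * g₄⁻¹) =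
      (g₁ * g₂ * (g₀⁻¹ * g₃) * (g₂ * g₁)⁻¹) * (g₄ * (g₀⁻¹ * g₃) * g₄⁻¹)⁻¹ := by
    rw [h02.inv_left.eq, h13.inv_left.eq]; group
  rw [e1, conj_eq_one_iff, e2, mul_inv_eq_one]

/-- The two elements on the right are the images of `g₀` and `g₂` under the half twist along side 1.
So the long relation says exactly that the twist preserves the commutation of `g₀` with `g₂`; all
later checks of the pentagon relation go through this form. -/
theorem pentagonProduct_eq_one_iff {H : Type*} [Group H] {g₀ g₁ g₂ g₃ g₄ : H}
    (h02 : Commute g₀ g₂) (h13 : Commute g₁ g₃) (h24 : Commute g₂ g₄) (h30 : Commute g₃ g₀)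
    (h41 : Commute g₄ g₁) :
    pentagonProduct g₀ g₁ g₂ g₃ g₄ = 1 ↔
      Commute (g₃ * g₀⁻¹ * g₁⁻¹) (g₄ * g₂⁻¹ * g₁⁻¹) := by
  have e3 : g₃ * g₀⁻¹ * g₁⁻¹ * (g₄ * g₂⁻¹ * g₁⁻¹) =
      (g₀⁻¹ * g₃) * ((g₂ * g₁)⁻¹ * g₄) * g₁⁻¹ := by
    rw [← ((h24.symm.mul_right h41).inv_right).eq, h30.inv_right.eq, mul_inv_rev]
    have := h41.inv_right.eq
    simp only [mul_assoc]
    rw [← mul_assoc g₄ g₁⁻¹, this]; simp only [mul_assoc]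
  have e4 : g₄ * g₂⁻¹ * g₁⁻¹ * (g₃ * g₀⁻¹ * g₁⁻¹) =
      (g₁ * g₂)⁻¹ * g₄ * (g₀⁻¹ * g₃) * g₁⁻¹ := by
    rw [← ((h41.mul_right h24.symm).inv_right).eq, h30.inv_right.eq]; group
  rw [commute_iff_eq, e3, e4, mul_left_inj, pentagonProduct_eq_one_iff_conj h02 h13]
  generalize g₀⁻¹ * g₃ = w
  constructor <;> intro h
  · calc w * ((g₂ * g₁)⁻¹ * g₄) = (g₁ * g₂)⁻¹ * (g₁ * g₂ * w * (g₂ * g₁)⁻¹) * g₄ := by group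
      _ = _ := by rw [h]; group
  · calc g₁ * g₂ * w * (g₂ * g₁)⁻¹ = (g₁ * g₂) * (w * ((g₂ * g₁)⁻¹ * g₄)) * g₄⁻¹ := by group
      _ = _ := by rw [h]; group

/-- Five elements of a group satisfying the pentagon relations. -/
structure IsPentagon {H : Type*} [Group H] (g : ZMod 5 → H) : Prop where
  comm : ∀ i, Commute (g i) (g (i + 2))
  pentagon : pentagonProduct (g 0) (g 1) (g 2) (g 3) (g 4) = 1

namespace IsPentagon

variable {H : Type*} [Group H] {g : ZMod 5 → H}

theorem rotate_one (h : IsPentagon g) : IsPentagon fun j => g (j + 1) where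
  comm i := by
    have := h.comm (i + 1)
    rwa [add_right_comm] at this
  pentagon := pentagonProduct_rotate h.pentagon

theorem rotate (h : IsPentagon g) (i : ZMod 5) : IsPentagon fun j => g (j + i) := by
  obtain ⟨n, rfl⟩ : ∃ n : ℕ, (n : ZMod 5) = i := ⟨i.val, by simp⟩
  induction n with
  | zero => simpa using h
  | succ n ih => simpa [add_assoc, add_comm (1 : ZMod 5)] using ih.rotate_one

theorem h02 (h : IsPentagon g) : Commute (g 0) (g 2) := h.comm 0
theorem h13 (h : IsPentagon g) : Commute (g 1) (g 3) := h.comm 1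
theorem h24 (h : IsPentagon g) : Commute (g 2) (g 4) := h.comm 2
theorem h30 (h : IsPentagon g) : Commute (g 3) (g 0) := h.comm 3
theorem h41 (h : IsPentagon g) : Commute (g 4) (g 1) := h.comm 4

theorem of_commute (h02 : Commute (g 0) (g 2)) (h13 : Commute (g 1) (g 3))
    (h24 : Commute (g 2) (g 4)) (h30 : Commute (g 3) (g 0)) (h41 : Commute (g 4) (g 1))
    (h : Commute (g 3 * (g 0)⁻¹ * (g 1)⁻¹) (g 4 * (g 2)⁻¹ * (g 1)⁻¹)) : IsPentagon g where
  comm i := by fin_cases i <;> assumption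
  pentagon := (pentagonProduct_eq_one_iff h02 h13 h24 h30 h41).2 h

theorem commute_twist (h : IsPentagon g) :
    Commute (g 3 * (g 0)⁻¹ * (g 1)⁻¹) (g 4 * (g 2)⁻¹ * (g 1)⁻¹) :=
  (pentagonProduct_eq_one_iff h.h02 h.h13 h.h24 h.h30 h.h41).1 h.pentagon

theorem lift_relations (h : IsPentagon g) : ∀ r ∈ pentagonRelations, FreeGroup.lift g r = 1 := by
  rintro r (⟨i, j, h1, h2, rfl⟩ | rfl)
  · have : Commute (g i) (g j) := by
      have key : i = j ∨ j = i + 2 ∨ i = j + 2 := by revert i j; decide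
      rcases key with rfl | rfl | rfl
      exacts [Commute.refl _, h.comm _, (h.comm _).symm]
    simp [pentagonCommutator, this.eq]
  · simpa [pentagonCommutator, pentagonProduct] using h.pentagon

end IsPentagon

/-- The group with five generators subject to the pentagon relations. -/
abbrev PentagonGroup : Type := PresentedGroup pentagonRelations

namespace PentagonGroup

/-- The generators of `PentagonGroup`. -/
abbrev gen (i : ZMod 5) : PentagonGroup := PresentedGroup.of i

theorem isPentagon_gen : IsPentagon gen where
  comm i := by
    have : PresentedGroup.mk pentagonRelations (pentagonCommutator i (i + 2)) = 1 :=
      PresentedGroup.one_of_mem (Or.inl ⟨i, i + 2, by revert i; decide, by revert i; decide, rfl⟩)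
    rw [commute_iff_eq, ← mul_inv_eq_one]
    simp only [pentagonCommutator, map_mul, map_inv] at this
    rw [mul_inv_rev, ← mul_assoc]
    exact this
  pentagon := by
    have := PresentedGroup.one_of_mem (rels := pentagonRelations) (Or.inr rfl)
    simp only [pentagonCommutator, map_mul, map_inv] at this
    exact this

/-- The morphism from `PentagonGroup` given by five elements satisfying the pentagon relations. -/
def lift {H : Type*} [Group H] {g : ZMod 5 → H} (h : IsPentagon g) : PentagonGroup →* H :=
  PresentedGroup.toGroup h.lift_relations

@[simp]
theorem lift_gen {H : Type*} [Group H] {g : ZMod 5 → H} (h : IsPentagon g) (i : ZMod 5) :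
    lift h (gen i) = g i :=
  PresentedGroup.toGroup.of _

end PentagonGroup

/-! ### Half twists and their braid relations. -/

/-- The effect on five elements satisfying the pentagon relations of the half twist along the
`i`-th side. -/
def pentagonTwist {H : Type*} [Group H] (g : ZMod 5 → H) (i j : ZMod 5) : H :=
  if j = i + 1 then g (i + 3) * (g (i + 1))⁻¹ * (g i)⁻¹
  else if j = i + 4 then g (i + 2) * (g (i + 4))⁻¹ * (g i)⁻¹
  else g j

theorem pentagonTwist_rotate {H : Type*} [Group H] (g : ZMod 5 → H) (i j : ZMod 5) :
    pentagonTwist (fun k => g (k + i)) 1 j = pentagonTwist g (i + 1) (j + i) := by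
  fin_cases i <;> fin_cases j <;> rfl

/-- The left side is what the formula for a twisted element becomes when the twist is applied a
second time; hence two half twists make a conjugation. -/
theorem mul_inv_twist_mul_inv {H : Type*} [Group H] {x y z : H} (hx : Commute z x)
    (hy : Commute z y) : z * (z * x⁻¹ * y⁻¹)⁻¹ * y⁻¹ = y * x * y⁻¹ := by
  calc z * (z * x⁻¹ * y⁻¹)⁻¹ * y⁻¹ = z * (y * x) * z⁻¹ * y⁻¹ := by group
    _ = y * x * y⁻¹ := by rw [(hy.mul_right hx).eq]; group

namespace IsPentagon

variable {H : Type*} [Group H] {g : ZMod 5 → H}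

/-- The twist exchanges two relations: the new commutation of elements 0 and 2 is the old pentagon
relation, and the new pentagon relation is the old commutation conjugated by `g 1`. -/
theorem twist_one (h : IsPentagon g) : IsPentagon (pentagonTwist g 1) := by
  have h02 := h.h02; have h13 := h.h13; have h24 := h.h24; have h30 := h.h30; have h41 := h.h41
  have e0 : pentagonTwist g 1 0 = g 3 * (g 0)⁻¹ * (g 1)⁻¹ := rfl
  have e1 : pentagonTwist g 1 1 = g 1 := rfl
  have e2 : pentagonTwist g 1 2 = g 4 * (g 2)⁻¹ * (g 1)⁻¹ := rfl
  have e3 : pentagonTwist g 1 3 = g 3 := rfl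
  have e4 : pentagonTwist g 1 4 = g 4 := rfl
  apply of_commute <;> simp only [e0, e1, e2, e3, e4]
  · exact h.commute_twist
  · exact h13
  · exact ((((Commute.refl _).mul_right h24.symm.inv_right).mul_right h41.inv_right)).symm
  · exact ((Commute.refl _).mul_right h30.inv_right).mul_right h13.symm.inv_right
  · exact h41
  · rw [mul_inv_twist_mul_inv h30 h13.symm, mul_inv_twist_mul_inv h24.symm h41]
    exact (Commute.conj_iff _).2 h02

theorem twist (h : IsPentagon g) (i : ZMod 5) : IsPentagon (pentagonTwist g i) := by
  -- Rotating the indices brings side `i` to side 1 and back.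
  have := ((h.rotate (i - 1)).twist_one).rotate (1 - i)
  simpa [pentagonTwist_rotate, add_assoc] using this

end IsPentagon

namespace PentagonGroup

/-- The half twist along the `i`-th side, as an endomorphism of `PentagonGroup`. -/
def twistHom (i : ZMod 5) : PentagonGroup →* PentagonGroup :=
  lift (isPentagon_gen.twist i)

theorem twistHom_gen (i j : ZMod 5) : twistHom i (gen j) = pentagonTwist gen i j :=
  lift_gen _ _

theorem twistHom_twistHom (i : ZMod 5) (x : PentagonGroup) :
    twistHom i (twistHom i x) = gen i * x * (gen i)⁻¹ := by
  have h := isPentagon_gen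
  suffices (twistHom i).comp (twistHom i) = (MulAut.conj (gen i)).toMonoidHom from
    DFunLike.congr_fun this x
  refine PresentedGroup.ext fun j => ?_
  change twistHom i (twistHom i (gen j)) = gen i * gen j * (gen i)⁻¹
  have t0 : twistHom i (gen i) = gen i := by rw [twistHom_gen]; fin_cases i <;> rfl
  have t1 : twistHom i (gen (i + 1)) = gen (i + 3) * (gen (i + 1))⁻¹ * (gen i)⁻¹ := by
    rw [twistHom_gen]; fin_cases i <;> rfl
  have t2 : twistHom i (gen (i + 2)) = gen (i + 2) := by rw [twistHom_gen]; fin_cases i <;> rfl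
  have t3 : twistHom i (gen (i + 3)) = gen (i + 3) := by rw [twistHom_gen]; fin_cases i <;> rfl
  have t4 : twistHom i (gen (i + 4)) = gen (i + 2) * (gen (i + 4))⁻¹ * (gen i)⁻¹ := by
    rw [twistHom_gen]; fin_cases i <;> rfl
  have c02 := h.comm i
  have c13 : Commute (gen (i + 1)) (gen (i + 3)) := by
    have := h.comm (i + 1); rwa [add_assoc] at this
  have c24 : Commute (gen (i + 2)) (gen (i + 4)) := by
    have := h.comm (i + 2); rwa [add_assoc] at this
  have c30 : Commute (gen (i + 3)) (gen i) := by
    have := h.comm (i + 3); rwa [add_assoc, show (3 + 2 : ZMod 5) = 0 from rfl, add_zero] at this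
  have key : j = i ∨ j = i + 1 ∨ j = i + 2 ∨ j = i + 3 ∨ j = i + 4 := by
    clear * -; revert i j; decide
  rcases key with rfl | rfl | rfl | rfl | rfl
  · simp [t0]
  · rw [t1, map_mul, map_mul, map_inv, map_inv, t0, t1, t3, mul_inv_twist_mul_inv c13.symm c30]
  · rw [t2, t2, c02.eq, mul_inv_cancel_right]
  · rw [t3, t3, ← c30.eq, mul_inv_cancel_right]
  · rw [t4, map_mul, map_mul, map_inv, map_inv, t0, t4, t2, mul_inv_twist_mul_inv c24 c02.symm]

/-- The half twist along the `i`-th side, as an automorphism of `PentagonGroup`. -/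
def twist (i : ZMod 5) : MulAut PentagonGroup :=
  -- The square is conjugation by `gen i`, so undoing that conjugation after one more twist inverts
  -- the twist.
  MonoidHom.toMulEquiv (twistHom i) ((MulAut.conj (gen i)⁻¹).toMonoidHom.comp (twistHom i))
    (by ext1 x; simp [twistHom_twistHom, mul_assoc])
    (by
      have t0 : twistHom i (gen i) = gen i := by rw [twistHom_gen]; fin_cases i <;> rfl
      refine MonoidHom.ext fun x => ?_
      simp [twistHom_twistHom, t0, mul_assoc])

theorem twist_gen (i j : ZMod 5) : twist i (gen j) = pentagonTwist gen i j :=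
  twistHom_gen i j

theorem twist_mul_twist (i : ZMod 5) : twist i * twist i = MulAut.conj (gen i) :=
  MulEquiv.ext fun x => twistHom_twistHom i x

theorem mulAut_ext {f g : MulAut PentagonGroup} (h : ∀ i, f (gen i) = g (gen i)) : f = g :=
  MulEquiv.toMonoidHom_injective (PresentedGroup.ext h)

theorem twist_one_gen_zero : twist 1 (gen 0) = gen 3 * (gen 0)⁻¹ * (gen 1)⁻¹ := twist_gen 1 0
theorem twist_one_gen_one : twist 1 (gen 1) = gen 1 := twist_gen 1 1
theorem twist_one_gen_two : twist 1 (gen 2) = gen 4 * (gen 2)⁻¹ * (gen 1)⁻¹ := twist_gen 1 2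
theorem twist_one_gen_three : twist 1 (gen 3) = gen 3 := twist_gen 1 3
theorem twist_one_gen_four : twist 1 (gen 4) = gen 4 := twist_gen 1 4
theorem twist_two_gen_zero : twist 2 (gen 0) = gen 0 := twist_gen 2 0
theorem twist_two_gen_one : twist 2 (gen 1) = gen 4 * (gen 1)⁻¹ * (gen 2)⁻¹ := twist_gen 2 1
theorem twist_two_gen_two : twist 2 (gen 2) = gen 2 := twist_gen 2 2
theorem twist_two_gen_three : twist 2 (gen 3) = gen 0 * (gen 3)⁻¹ * (gen 2)⁻¹ := twist_gen 2 3
theorem twist_two_gen_four : twist 2 (gen 4) = gen 4 := twist_gen 2 4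
theorem twist_three_gen_zero : twist 3 (gen 0) = gen 0 := twist_gen 3 0
theorem twist_three_gen_one : twist 3 (gen 1) = gen 1 := twist_gen 3 1
theorem twist_three_gen_two : twist 3 (gen 2) = gen 0 * (gen 2)⁻¹ * (gen 3)⁻¹ := twist_gen 3 2
theorem twist_three_gen_three : twist 3 (gen 3) = gen 3 := twist_gen 3 3
theorem twist_three_gen_four : twist 3 (gen 4) = gen 1 * (gen 4)⁻¹ * (gen 3)⁻¹ := twist_gen 3 4

theorem mul_inv_mul_inv_twist {H : Type*} [Group H] {y z : H} (h : Commute y z) (x : H) :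
    y * x⁻¹ * (y * z⁻¹ * x⁻¹)⁻¹ = z := by
  calc y * x⁻¹ * (y * z⁻¹ * x⁻¹)⁻¹ = y * z * y⁻¹ := by group
    _ = z := by rw [h.eq, mul_inv_cancel_right]

theorem twist_two_twist_one_gen_two : twist 2 (twist 1 (gen 2)) = gen 1 := by
  simp only [twist_one_gen_two, map_mul, map_inv, twist_two_gen_one, twist_two_gen_two,
    twist_two_gen_four]
  exact mul_inv_mul_inv_twist isPentagon_gen.h41 _

theorem twist_one_twist_two_gen_one : twist 1 (twist 2 (gen 1)) = gen 2 := by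
  simp only [twist_two_gen_one, map_mul, map_inv, twist_one_gen_one, twist_one_gen_two,
    twist_one_gen_four]
  exact mul_inv_mul_inv_twist isPentagon_gen.h24.symm _

theorem twist_three_twist_two_gen_three : twist 3 (twist 2 (gen 3)) = gen 2 := by
  simp only [twist_two_gen_three, map_mul, map_inv, twist_three_gen_two, twist_three_gen_three,
    twist_three_gen_zero]
  exact mul_inv_mul_inv_twist isPentagon_gen.h02 _

theorem twist_two_twist_three_gen_two : twist 2 (twist 3 (gen 2)) = gen 3 := by
  simp only [twist_three_gen_two, map_mul, map_inv, twist_two_gen_two, twist_two_gen_three,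
    twist_two_gen_zero]
  exact mul_inv_mul_inv_twist isPentagon_gen.h30.symm _

theorem conj_mul_inv {H : Type*} [Group H] {x y z : H} (hy : Commute x y) (hz : Commute x z)
    (u w : H) : x * y⁻¹ * z⁻¹ * x⁻¹ * (w * u⁻¹ * z⁻¹)⁻¹ = y⁻¹ * u * w⁻¹ := by
  rw [mul_assoc x, (hy.inv_right.mul_right hz.inv_right).eq]
  group

/-- The result involves only generators fixed by `twist 2`, which is what the braid relation needs
on `gen 3`. The three lemmas after it play the same role. -/
theorem twist_one_twist_two_gen_three :
    twist 1 (twist 2 (gen 3)) = (gen 0)⁻¹ * gen 2 * (gen 4)⁻¹ := by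
  simp only [twist_two_gen_three, map_mul, map_inv, twist_one_gen_zero, twist_one_gen_two,
    twist_one_gen_three]
  exact conj_mul_inv isPentagon_gen.h30 isPentagon_gen.h13.symm _ _

theorem twist_three_twist_two_gen_one :
    twist 3 (twist 2 (gen 1)) = (gen 4)⁻¹ * gen 2 * (gen 0)⁻¹ := by
  simp only [twist_two_gen_one, map_mul, map_inv, twist_three_gen_one, twist_three_gen_two,
    twist_three_gen_four]
  exact conj_mul_inv isPentagon_gen.h41.symm isPentagon_gen.h13 _ _

theorem twist_two_twist_one_gen_zero :
    twist 2 (twist 1 (gen 0)) = (gen 3)⁻¹ * gen 1 * (gen 4)⁻¹ := by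
  simp only [twist_one_gen_zero, map_mul, map_inv, twist_two_gen_zero, twist_two_gen_three,
    twist_two_gen_one]
  exact conj_mul_inv isPentagon_gen.h30.symm isPentagon_gen.h02 _ _

theorem twist_two_twist_three_gen_four :
    twist 2 (twist 3 (gen 4)) = (gen 1)⁻¹ * gen 3 * (gen 0)⁻¹ := by
  simp only [twist_three_gen_four, map_mul, map_inv, twist_two_gen_four, twist_two_gen_one,
    twist_two_gen_three]
  exact conj_mul_inv isPentagon_gen.h41 isPentagon_gen.h24.symm _ _

theorem twist_one_braid : twist 1 * twist 2 * twist 1 = twist 2 * twist 1 * twist 2 := by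
  refine mulAut_ext fun i => ?_
  simp only [MulAut.mul_apply]
  fin_cases i
  · change twist 1 (twist 2 (twist 1 (gen 0))) = twist 2 (twist 1 (twist 2 (gen 0)))
    simp only [twist_two_gen_zero, twist_two_twist_one_gen_zero, map_mul, map_inv,
      twist_one_gen_three, twist_one_gen_one, twist_one_gen_four]
  · change twist 1 (twist 2 (twist 1 (gen 1))) = twist 2 (twist 1 (twist 2 (gen 1)))
    rw [twist_one_gen_one, twist_one_twist_two_gen_one, twist_two_gen_two]
  · change twist 1 (twist 2 (twist 1 (gen 2))) = twist 2 (twist 1 (twist 2 (gen 2)))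
    rw [twist_two_gen_two, twist_two_twist_one_gen_two, twist_one_gen_one]
  · change twist 1 (twist 2 (twist 1 (gen 3))) = twist 2 (twist 1 (twist 2 (gen 3)))
    simp only [twist_one_gen_three, twist_one_twist_two_gen_three, map_mul, map_inv,
      twist_two_gen_zero, twist_two_gen_two, twist_two_gen_four]
  · change twist 1 (twist 2 (twist 1 (gen 4))) = twist 2 (twist 1 (twist 2 (gen 4)))
    simp only [twist_one_gen_four, twist_two_gen_four]

theorem twist_two_braid : twist 2 * twist 3 * twist 2 = twist 3 * twist 2 * twist 3 := by
  refine mulAut_ext fun i => ?_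
  simp only [MulAut.mul_apply]
  fin_cases i
  · change twist 2 (twist 3 (twist 2 (gen 0))) = twist 3 (twist 2 (twist 3 (gen 0)))
    simp only [twist_two_gen_zero, twist_three_gen_zero]
  · change twist 2 (twist 3 (twist 2 (gen 1))) = twist 3 (twist 2 (twist 3 (gen 1)))
    simp only [twist_three_gen_one, twist_three_twist_two_gen_one, map_mul, map_inv,
      twist_two_gen_zero, twist_two_gen_two, twist_two_gen_four]
  · change twist 2 (twist 3 (twist 2 (gen 2))) = twist 3 (twist 2 (twist 3 (gen 2)))
    rw [twist_two_gen_two, twist_two_twist_three_gen_two, twist_three_gen_three]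
  · change twist 2 (twist 3 (twist 2 (gen 3))) = twist 3 (twist 2 (twist 3 (gen 3)))
    rw [twist_three_gen_three, twist_three_twist_two_gen_three, twist_two_gen_two]
  · change twist 2 (twist 3 (twist 2 (gen 4))) = twist 3 (twist 2 (twist 3 (gen 4)))
    simp only [twist_two_gen_four, twist_two_twist_three_gen_four, map_mul, map_inv,
      twist_three_gen_zero, twist_three_gen_one, twist_three_gen_three]

/-- Only `gen 2` is moved by both twists. For it the equality amounts to the pentagon relation read
from index 3, in the form of `pentagonProduct_eq_one_iff_conj`; each other generator is moved by at
most one twist, into a word fixed by the other. -/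
theorem twist_one_comm_twist_three : twist 1 * twist 3 = twist 3 * twist 1 := by
  refine mulAut_ext fun i => ?_
  simp only [MulAut.mul_apply]
  fin_cases i
  · change twist 1 (twist 3 (gen 0)) = twist 3 (twist 1 (gen 0))
    simp only [twist_three_gen_zero, twist_one_gen_zero, map_mul, map_inv, twist_three_gen_one,
      twist_three_gen_three]
  · change twist 1 (twist 3 (gen 1)) = twist 3 (twist 1 (gen 1))
    simp only [twist_three_gen_one, twist_one_gen_one]
  · change twist 1 (twist 3 (gen 2)) = twist 3 (twist 1 (gen 2))
    simp only [twist_three_gen_two, twist_one_gen_two, map_mul, map_inv, twist_three_gen_one,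
      twist_three_gen_four, twist_one_gen_zero, twist_one_gen_three]
    have h := isPentagon_gen
    have p : gen 4 * gen 0 * ((gen 3)⁻¹ * gen 1) * (gen 0 * gen 4)⁻¹ =
        gen 2 * ((gen 3)⁻¹ * gen 1) * (gen 2)⁻¹ :=
      (pentagonProduct_eq_one_iff_conj h.h30 h.h41).1 (h.rotate 3).pentagon
    have c1 : Commute (gen 4 * gen 0)⁻¹ (gen 2) := (h.h24.symm.mul_left h.h02).inv_left
    have c2 : Commute (gen 0 * gen 4) (gen 2)⁻¹ := (h.h02.mul_left h.h24.symm).inv_right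
    rw [← mul_inv_eq_one]
    calc _ = gen 3 * ((gen 0)⁻¹ * gen 2) * (gen 4)⁻¹ * ((gen 3)⁻¹ * gen 1) *
          (gen 0 * ((gen 2)⁻¹ * gen 4)) * (gen 1)⁻¹ := by group
      _ = gen 3 * (gen 2 * (gen 4 * gen 0)⁻¹) * ((gen 3)⁻¹ * gen 1) *
          ((gen 0 * gen 4) * (gen 2)⁻¹) * (gen 1)⁻¹ := by
        rw [h.h02.inv_left.eq, h.h24.inv_left.eq]; group
      _ = gen 3 * (gen 4 * gen 0)⁻¹ * (gen 2 * ((gen 3)⁻¹ * gen 1) * (gen 2)⁻¹) *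
          (gen 0 * gen 4) * (gen 1)⁻¹ := by rw [← c1.eq, c2.eq]; group
      _ = 1 := by rw [← p]; group
  · change twist 1 (twist 3 (gen 3)) = twist 3 (twist 1 (gen 3))
    simp only [twist_three_gen_three, twist_one_gen_three]
  · change twist 1 (twist 3 (gen 4)) = twist 3 (twist 1 (gen 4))
    simp only [twist_three_gen_four, twist_one_gen_four, map_mul, map_inv, twist_one_gen_one,
      twist_one_gen_three]

end PentagonGroup

/-! ### The pentagon group as a semidirect product of free groups; its trivial centre. -/

/-- If the reduced word of `z` begins with the letter `x` or its inverse, take `c ≠ x`. Then `c * z`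
has reduced word `c :: z`, while that of `z * c` is a sublist of `z ++ [c]`; equal lengths force
equality, and the first letters disagree. -/
theorem FreeGroup.eq_one_of_forall_commute {α : Type*} [DecidableEq α] [Nontrivial α]
    {z : FreeGroup α} (h : ∀ x, Commute (FreeGroup.of x) z) : z = 1 := by
  rw [← FreeGroup.toWord_eq_nil_iff]
  rcases hw : z.toWord with _ | ⟨⟨x, e⟩, w⟩
  · rfl
  exfalso
  obtain ⟨c, hc⟩ := exists_ne x
  have hz : FreeGroup.reduce z.toWord = z.toWord := FreeGroup.reduce_toWord z
  have h1 : (FreeGroup.of c * z).toWord = (c, true) :: z.toWord := by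
    rw [FreeGroup.toWord_mul, FreeGroup.toWord_of, List.singleton_append, FreeGroup.reduce.cons, hz,
      hw]
    simp [hc]
  have h2 : List.Sublist (z * FreeGroup.of c).toWord (z.toWord ++ [(c, true)]) := by
    rw [FreeGroup.toWord_mul, FreeGroup.toWord_of]
    exact FreeGroup.reduce.red.sublist
  rw [← (h c).eq, h1] at h2
  have h3 := h2.eq_of_length (by simp)
  rw [hw] at h3
  simp at h3
  exact hc h3.1.1

/-- The relations of the semidirect product of the free groups on `a, b, d` and on `p, q`, where
`p` and `q` act as the pure braids on three strands acting on the fundamental group of a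
thrice punctured disc. -/
structure IsFreeByFree {H : Type*} [Group H] (a b d p q : H) : Prop where
  pa : p * a * p⁻¹ = (a * b)⁻¹ * a * (a * b)
  pb : p * b * p⁻¹ = (a * b)⁻¹ * b * (a * b)
  pd : p * d * p⁻¹ = d
  qa : q * a * q⁻¹ = a
  qb : q * b * q⁻¹ = d * a * b * (d * a)⁻¹
  qd : q * d * q⁻¹ = d

namespace IsFreeByFree

variable {H : Type*} [Group H] {a b d p q : H}

theorem mul_mul_inv_mul_inv (h : IsFreeByFree a b d p q) : a * b * p * a⁻¹ * p⁻¹ = b := by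
  calc a * b * p * a⁻¹ * p⁻¹ = a * b * (p * a * p⁻¹)⁻¹ := by group
    _ = b := by rw [h.pa]; group

theorem isPentagon {g : ZMod 5 → H} (h : IsFreeByFree (g 0) b (g 4) (g 1) (g 2))
    (h3 : g 3 = g 0 * b * g 1) : IsPentagon g := by
  have hab : g 1 * (g 0 * b) * (g 1)⁻¹ = g 0 * b := by
    calc g 1 * (g 0 * b) * (g 1)⁻¹ = (g 1 * g 0 * (g 1)⁻¹) * (g 1 * b * (g 1)⁻¹) := by group
      _ = g 0 * b := by rw [h.pa, h.pb]; group
  apply IsPentagon.of_commute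
  · exact (mul_inv_eq_iff_eq_mul.1 h.qa).symm
  · rw [h3]
    exact Commute.mul_right (mul_inv_eq_iff_eq_mul.1 hab) (Commute.refl _)
  · exact mul_inv_eq_iff_eq_mul.1 h.qd
  · rw [h3, commute_iff_eq]
    calc g 0 * b * g 1 * g 0 = g 0 * b * (g 1 * g 0 * (g 1)⁻¹) * g 1 := by group
      _ = _ := by rw [h.pa]; group
  · exact (mul_inv_eq_iff_eq_mul.1 h.pd).symm
  · rw [h3, h.mul_mul_inv_mul_inv]
    -- Since `b` is the twisted `g 0`, the pentagon relation is the commutation of `b` with the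
    -- inverse of this product.
    suffices Commute b (g 1 * g 2 * (g 4)⁻¹) by
      simpa [mul_assoc] using this.inv_right
    refine (mul_inv_eq_iff_eq_mul.1 ?_).symm
    calc g 1 * g 2 * (g 4)⁻¹ * b * (g 1 * g 2 * (g 4)⁻¹)⁻¹ =
        g 1 * ((g 2 * g 4 * (g 2)⁻¹)⁻¹ * (g 2 * b * (g 2)⁻¹) * (g 2 * g 4 * (g 2)⁻¹)) *
          (g 1)⁻¹ := by group
      _ = (g 1 * g 0 * (g 1)⁻¹) * (g 1 * b * (g 1)⁻¹) * (g 1 * g 0 * (g 1)⁻¹)⁻¹ := by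
        rw [h.qd, h.qb]; group
      _ = b := by rw [h.pa, h.pb]; group

end IsFreeByFree

/-- Converse of `IsFreeByFree.isPentagon`: solving `g 3 = g 0 * b * g 1` for `b` forces the second
entry, and the pentagon relation, as `commute_twist`, supplies the action of `g 2` on `b`. -/
theorem IsPentagon.isFreeByFree {H : Type*} [Group H] {g : ZMod 5 → H} (h : IsPentagon g) :
    IsFreeByFree (g 0) (g 3 * (g 0)⁻¹ * (g 1)⁻¹) (g 4) (g 1) (g 2) := by
  have hab : g 0 * (g 3 * (g 0)⁻¹ * (g 1)⁻¹) = g 3 * (g 1)⁻¹ := by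
    rw [h.h30.inv_right.eq]; group
  have hd : g 2 * g 4 * (g 2)⁻¹ = g 4 := by rw [h.h24.eq, mul_inv_cancel_right]
  refine ⟨?_, ?_, ?_, ?_, ?_, hd⟩
  · rw [hab]
    calc g 1 * g 0 * (g 1)⁻¹ = g 1 * (g 3)⁻¹ * (g 3 * g 0) * (g 1)⁻¹ := by group
      _ = _ := by rw [h.h30.eq]; group
  · rw [hab]
    have : Commute (g 3) (g 3 * (g 0)⁻¹ * (g 1)⁻¹) :=
      ((Commute.refl _).mul_right h.h30.inv_right).mul_right h.h13.symm.inv_right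
    generalize g 3 * (g 0)⁻¹ * (g 1)⁻¹ = b at *
    calc g 1 * b * (g 1)⁻¹ = g 1 * (g 3)⁻¹ * (g 3 * b) * (g 1)⁻¹ := by group
      _ = _ := by rw [this.eq]; group
  · rw [← h.h41.eq, mul_inv_cancel_right]
  · rw [← h.h02.eq, mul_inv_cancel_right]
  · have e : g 0 * (g 3 * (g 0)⁻¹ * (g 1)⁻¹) * (g 0)⁻¹ =
        (g 1)⁻¹ * (g 3 * (g 0)⁻¹ * (g 1)⁻¹) * g 1 := by
      rw [hab, ← mul_assoc, ← mul_assoc, h.h13.inv_left.eq]; group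
    have c := h.commute_twist
    generalize g 3 * (g 0)⁻¹ * (g 1)⁻¹ = b at *
    have c' : Commute b (g 1 * g 2 * (g 4)⁻¹) := by simpa [mul_assoc] using c.inv_right
    calc g 2 * b * (g 2)⁻¹ = (g 2 * g 4 * (g 2)⁻¹) * (g 1)⁻¹ * (g 1 * g 2 * (g 4)⁻¹ * b) *
          (g 2)⁻¹ := by group
      _ = g 4 * ((g 1)⁻¹ * b * g 1) * (g 2 * (g 4)⁻¹ * (g 2)⁻¹) := by rw [← c'.eq, hd]; group
      _ = _ := by rw [← e, h.h24.inv_right.eq]; group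

/-- The automorphism of the free group on `a, b, d` which conjugates `a` and `b` by `(ab)⁻¹`. -/
def freeTwistLeft : MulAut (FreeGroup (Fin 3)) :=
  let a := FreeGroup.of (0 : Fin 3)
  let b := FreeGroup.of (1 : Fin 3)
  let d := FreeGroup.of (2 : Fin 3)
  MonoidHom.toMulEquiv
    (FreeGroup.lift ![(a * b)⁻¹ * a * (a * b), (a * b)⁻¹ * b * (a * b), d])
    (FreeGroup.lift ![(a * b) * a * (a * b)⁻¹, (a * b) * b * (a * b)⁻¹, d])
    (FreeGroup.ext_hom _ _ fun i => by fin_cases i <;> simp [a, b, d] <;> group)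
    (FreeGroup.ext_hom _ _ fun i => by fin_cases i <;> simp [a, b, d] <;> group)

/-- The automorphism of the free group on `a, b, d` which conjugates `b` by `da`. -/
def freeTwistRight : MulAut (FreeGroup (Fin 3)) :=
  let a := FreeGroup.of (0 : Fin 3)
  let b := FreeGroup.of (1 : Fin 3)
  let d := FreeGroup.of (2 : Fin 3)
  MonoidHom.toMulEquiv
    (FreeGroup.lift ![a, d * a * b * (d * a)⁻¹, d])
    (FreeGroup.lift ![a, (d * a)⁻¹ * b * (d * a), d])
    (FreeGroup.ext_hom _ _ fun i => by fin_cases i <;> simp [a, b, d]; group)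
    (FreeGroup.ext_hom _ _ fun i => by fin_cases i <;> simp [a, b, d]; group)

/-- The action of the free group on `p, q` on the free group on `a, b, d`. -/
def freeTwist : FreeGroup (Fin 2) →* MulAut (FreeGroup (Fin 3)) :=
  FreeGroup.lift ![freeTwistLeft, freeTwistRight]

namespace FreeByFree

open SemidirectProduct

/-- The semidirect product of the free groups on `a, b, d` and on `p, q`. -/
abbrev _root_.FreeByFree : Type := FreeGroup (Fin 3) ⋊[freeTwist] FreeGroup (Fin 2)

theorem isFreeByFree : IsFreeByFree (H := FreeByFree) (inl (.of 0)) (inl (.of 1)) (inl (.of 2))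
    (inr (.of 0)) (inr (.of 1)) := by
  constructor <;> simp only [← inl_aut, ← map_mul, ← map_inv, inl_inj] <;>
    simp [freeTwist, freeTwistLeft, freeTwistRight]

/-- The elements of `FreeByFree` corresponding to the generators of `PentagonGroup`. -/
def pentagonGen (i : ZMod 5) : FreeByFree :=
  if i = 0 then inl (.of 0) else if i = 1 then inr (.of 0) else if i = 2 then inr (.of 1)
  else if i = 3 then inl (.of 0) * inl (.of 1) * inr (.of 0) else inl (.of 2)

theorem isPentagon_pentagonGen : IsPentagon pentagonGen :=
  IsFreeByFree.isPentagon (b := inl (.of 1)) (by exact isFreeByFree) (by rfl)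

/-- The morphism from `FreeByFree` given by five elements satisfying its relations. -/
def lift {H : Type*} [Group H] {a b d p q : H} (h : IsFreeByFree a b d p q) : FreeByFree →* H :=
  SemidirectProduct.lift (FreeGroup.lift ![a, b, d]) (FreeGroup.lift ![p, q]) <| by
    have hi : ∀ i, (FreeGroup.lift ![a, b, d]).comp (freeTwist (.of i)).toMonoidHom =
        (MulAut.conj (FreeGroup.lift ![p, q] (.of i))).toMonoidHom.comp
          (FreeGroup.lift ![a, b, d]) := by
      obtain ⟨h1, h2, h3, h4, h5, h6⟩ := h
      intro i
      refine FreeGroup.ext_hom _ _ fun j => ?_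
      fin_cases i <;> fin_cases j <;>
        simp [freeTwist, freeTwistLeft, freeTwistRight, h1, h2, h3, h4, h5, h6]
    intro g
    induction g using FreeGroup.induction_on with
    | C1 => ext; simp
    | of i => exact hi i
    | inv_of i hi' =>
      refine MonoidHom.ext fun x => ?_
      have := DFunLike.congr_fun hi' ((freeTwist (.of i))⁻¹ x)
      simp only [MonoidHom.comp_apply, MulEquiv.coe_toMonoidHom, MulAut.apply_inv_self,
        MulAut.conj_apply] at this
      simp only [MonoidHom.comp_apply, MulEquiv.coe_toMonoidHom, this, map_inv, MulAut.conj_inv_apply]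
      group
    | mul x y hx hy =>
      refine MonoidHom.ext fun z => ?_
      have h1 := DFunLike.congr_fun hx (freeTwist y z)
      have h2 := DFunLike.congr_fun hy z
      simp only [MonoidHom.comp_apply, MulEquiv.coe_toMonoidHom, MulAut.conj_apply] at h1 h2
      simp only [MonoidHom.comp_apply, MulEquiv.coe_toMonoidHom, MulAut.conj_apply, map_mul,
        MulAut.mul_apply, h1, h2]
      group

/-- A central element maps to the centre of the free quotient, so it lies in the free kernel and is
central there. -/
theorem eq_one_of_forall_commute {z : FreeByFree} (h : ∀ x, Commute x z) : z = 1 := by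
  have hr : z.right = 1 := by
    refine FreeGroup.eq_one_of_forall_commute fun x => ?_
    exact (h (inr (.of x))).map (rightHom (φ := freeTwist))
  have hz : z = inl z.left := by ext <;> simp [hr]
  have hl : z.left = 1 := by
    refine FreeGroup.eq_one_of_forall_commute fun x => ?_
    have := h (inl (.of x))
    rw [hz, commute_iff_eq, ← map_mul, ← map_mul, inl_inj] at this
    exact this
  rw [hz, hl, map_one]

end FreeByFree

open PentagonGroup SemidirectProduct in
theorem PentagonGroup.eq_one_of_forall_commute {z : PentagonGroup} (h : ∀ x, Commute x z) :
    z = 1 := by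
  set f := PentagonGroup.lift FreeByFree.isPentagon_pentagonGen with hf
  set k := FreeByFree.lift PentagonGroup.isPentagon_gen.isFreeByFree with hk
  have f0 : f (gen 0) = inl (.of 0) := lift_gen _ _
  have f1 : f (gen 1) = inr (.of 0) := lift_gen _ _
  have f2 : f (gen 2) = inr (.of 1) := lift_gen _ _
  have f3 : f (gen 3) = inl (.of 0) * inl (.of 1) * inr (.of 0) := lift_gen _ _
  have f4 : f (gen 4) = inl (.of 2) := lift_gen _ _
  have ka : k (inl (.of 0)) = gen 0 := by simp [hk, FreeByFree.lift]
  have kb : k (inl (.of 1)) = gen 3 * (gen 0)⁻¹ * (gen 1)⁻¹ := by simp [hk, FreeByFree.lift]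
  have kd : k (inl (.of 2)) = gen 4 := by simp [hk, FreeByFree.lift]
  have kp : k (inr (.of 0)) = gen 1 := by simp [hk, FreeByFree.lift]
  have kq : k (inr (.of 1)) = gen 2 := by simp [hk, FreeByFree.lift]
  have hkf : k.comp f = MonoidHom.id _ := by
    refine PresentedGroup.ext fun i => ?_
    change k (f (gen i)) = gen i
    fin_cases i
    · exact (congrArg k f0).trans ka
    · exact (congrArg k f1).trans kp
    · exact (congrArg k f2).trans kq
    · refine (congrArg k f3).trans ?_
      rw [map_mul, map_mul, ka, kb, kp, isPentagon_gen.h30.inv_right.eq]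
      group
      rfl
    · exact (congrArg k f4).trans kd
  have hfk : f.comp k = MonoidHom.id _ := by
    refine SemidirectProduct.hom_ext (FreeGroup.ext_hom _ _ fun i => ?_)
      (FreeGroup.ext_hom _ _ fun i => ?_)
    · change f (k (inl (.of i))) = inl (.of i)
      fin_cases i
      · exact (congrArg f ka).trans f0
      · refine (congrArg f kb).trans ?_
        rw [map_mul, map_mul, map_inv, map_inv, f0, f1, f3]
        exact FreeByFree.isFreeByFree.mul_mul_inv_mul_inv
      · exact (congrArg f kd).trans f4
    · change f (k (inr (.of i))) = inr (.of i)
      fin_cases i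
      · exact (congrArg f kp).trans f1
      · exact (congrArg f kq).trans f2
  have hz : f z = 1 := FreeByFree.eq_one_of_forall_commute fun x => by
    have := (h (k x)).map f
    rwa [← MonoidHom.comp_apply, hfk] at this
  have : k (f z) = z := DFunLike.congr_fun hkf z
  rw [← this, hz, map_one]

/-! ### Identities in the braid group on four strands. -/

/-- Three elements of a group satisfying Artin's relations for the braid group on four strands. -/
structure IsBraidTriple {H : Type*} [Group H] (a b c : H) : Prop where
  aba : a * b * a = b * a * b
  bcb : b * c * b = c * b * c
  ac : a * c = c * a

namespace IsBraidTriple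

variable {H : Type*} [Group H] {a b c : H}

theorem symm (h : IsBraidTriple a b c) : IsBraidTriple c b a :=
  ⟨h.bcb.symm, h.aba.symm, h.ac.symm⟩

theorem map {K : Type*} [Group K] (h : IsBraidTriple a b c) (f : H →* K) :
    IsBraidTriple (f a) (f b) (f c) :=
  ⟨by simpa using congrArg f h.aba, by simpa using congrArg f h.bcb, by
    simpa using congrArg f h.ac⟩

/-- `a` commutes with the pure braid in which the last strand encircles the others. -/
theorem commute_left (h : IsBraidTriple a b c) : Commute a (c * b * a ^ 2 * b * c) := by
  calc a * (c * b * a ^ 2 * b * c) = (a * c) * b * a * a * b * c := by simp only [pow_two, mul_assoc]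
    _ = c * (a * b * a) * a * b * c := by rw [h.ac]; simp only [mul_assoc]
    _ = c * b * a * (b * a * b) * c := by rw [h.aba]; simp only [mul_assoc]
    _ = c * b * a * a * b * (a * c) := by rw [← h.aba]; simp only [mul_assoc]
    _ = c * b * a ^ 2 * b * c * a := by rw [h.ac]; simp only [pow_two, mul_assoc]

theorem commute_mid (h : IsBraidTriple a b c) : Commute b (c * b * a ^ 2 * b * c) := by
  calc b * (c * b * a ^ 2 * b * c) = (b * c * b) * a * a * b * c := by
        simp only [pow_two, mul_assoc]
    _ = c * b * (a * c) * a * b * c := by rw [h.bcb, h.ac]; simp only [mul_assoc]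
    _ = c * b * a * (c * a) * b * c := by simp only [mul_assoc]
    _ = c * b * a * (a * c) * b * c := by rw [h.ac]
    _ = c * b * a * a * (c * b * c) := by simp only [mul_assoc]
    _ = c * b * a ^ 2 * b * c * b := by rw [← h.bcb]; simp only [pow_two, mul_assoc]

theorem conj_sq_of_braid {H : Type*} [Group H] {a b : H} (h : a * b * a = b * a * b) :
    b * a ^ 2 * b⁻¹ = a⁻¹ * b ^ 2 * a := by
  calc b * a ^ 2 * b⁻¹ = a⁻¹ * (a * b * a) * a * b⁻¹ := by simp only [pow_two]; group
    _ = a⁻¹ * (b * a * b) * a * b⁻¹ := by rw [h]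
    _ = a⁻¹ * b * (a * b * a) * b⁻¹ := by simp only [mul_assoc]
    _ = a⁻¹ * b ^ 2 * a := by rw [h]; simp only [pow_two]; group

/-- The product of the pure generators which involve the first strand. -/
theorem prod_conj_sq (h : IsBraidTriple a b c) :
    a ^ 2 * (b * a ^ 2 * b⁻¹) * (c * b * a ^ 2 * (c * b)⁻¹) = a * b * c ^ 2 * b * a := by
  have hc : c * a⁻¹ = a⁻¹ * c := (Commute.inv_left h.ac).eq.symm
  have e : c * b * a ^ 2 * (c * b)⁻¹ = a⁻¹ * b⁻¹ * c ^ 2 * b * a := by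
    calc c * b * a ^ 2 * (c * b)⁻¹ = c * (b * a ^ 2 * b⁻¹) * c⁻¹ := by group
      _ = (c * a⁻¹) * b ^ 2 * (c * a⁻¹)⁻¹ := by rw [conj_sq_of_braid h.aba]; group
      _ = a⁻¹ * (c * b ^ 2 * c⁻¹) * a := by rw [hc]; group
      _ = _ := by rw [conj_sq_of_braid h.bcb]; group
  rw [e, conj_sq_of_braid h.aba]
  simp only [pow_two]
  group

/-- This and `sq_garside_three'` factor the full twist on three strands in two ways. Once the full
twist on four strands is trivial, it becomes the inverse of the pure braid of the last strand
(`inv_last`), and the factorisations turn into the conjugation formulas below. -/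
theorem sq_garside_three (h : IsBraidTriple a b c) :
    (a * b * a) ^ 2 = b * a ^ 2 * b * a ^ 2 := by
  calc (a * b * a) ^ 2 = (a * b * a) * a * b * a := by simp only [pow_two, mul_assoc]
    _ = b * a * (b * a * b) * a := by rw [h.aba]; simp only [mul_assoc]
    _ = _ := by rw [← h.aba]; simp only [pow_two, mul_assoc]

theorem sq_garside_three' (h : IsBraidTriple a b c) :
    (a * b * a) ^ 2 = a * b ^ 2 * a * b ^ 2 := by
  calc (a * b * a) ^ 2 = (b * a * b) * b * a * b := by rw [h.aba]; simp only [pow_two, mul_assoc]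
    _ = a * b * (a * b * a) * b := by rw [← h.aba]; simp only [mul_assoc]
    _ = _ := by rw [h.aba]; simp only [pow_two, mul_assoc]

/-- Garside's fundamental braid. -/
theorem garside_eq (h : IsBraidTriple a b c) : a * b * c * a * b * a = c * b * a * c * b * c := by
  calc a * b * c * a * b * a = a * b * (a * c) * b * a := by rw [h.ac]; simp only [mul_assoc]
    _ = b * a * (b * c * b) * a := by rw [← mul_assoc, h.aba]; simp only [mul_assoc]
    _ = b * (a * c) * b * c * a := by rw [h.bcb]; simp only [mul_assoc]
    _ = b * c * a * b * (a * c) := by rw [h.ac]; simp only [mul_assoc]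
    _ = b * c * (a * b * a) * c := by simp only [mul_assoc]
    _ = (b * c * b) * a * b * c := by rw [h.aba]; simp only [mul_assoc]
    _ = c * b * (c * a) * b * c := by rw [h.bcb]; simp only [mul_assoc]
    _ = _ := by rw [← h.ac]; simp only [mul_assoc]

/-- Garside's braid exchanges `a` and `c` and fixes `b` under conjugation; hence its square is
central. -/
theorem garside_mul_left (h : IsBraidTriple a b c) :
    a * b * c * a * b * a * a = c * (a * b * c * a * b * a) := by
  symm
  calc c * (a * b * c * a * b * a) = (c * a) * b * c * a * b * a := by simp only [mul_assoc]
    _ = a * (c * b * c) * a * b * a := by rw [← h.ac]; simp only [mul_assoc]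
    _ = a * b * c * b * (a * b * a) := by rw [← h.bcb]; simp only [mul_assoc]
    _ = a * b * c * (b * a * b) * a := by simp only [mul_assoc]
    _ = _ := by rw [← h.aba]; simp only [mul_assoc]

theorem garside_mul_mid (h : IsBraidTriple a b c) :
    a * b * c * a * b * a * b = b * (a * b * c * a * b * a) := by
  calc a * b * c * a * b * a * b = a * b * c * a * (b * a * b) := by simp only [mul_assoc]
    _ = a * b * (c * a) * a * b * a := by rw [← h.aba]; simp only [mul_assoc]
    _ = (a * b * a) * c * a * b * a := by rw [← h.ac]; simp only [mul_assoc]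
    _ = _ := by rw [h.aba]; simp only [mul_assoc]

theorem garside_mul_right (h : IsBraidTriple a b c) :
    a * b * c * a * b * a * c = a * (a * b * c * a * b * a) := by
  rw [h.garside_eq]
  exact h.symm.garside_mul_left

/-- The full twist on four strands is the full twist on three of them times the last strand's turn
around these. -/
theorem mul_sq_garside_three (h : IsBraidTriple a b c) :
    (c * b * a ^ 2 * b * c) * (a * b * a) ^ 2 = (a * b * c * a * b * a) ^ 2 := by
  have e : a * b * c * a * b * a * (a * b * a) = c * b * c * (a * b * c * a * b * a) := by
    rw [← mul_assoc, ← mul_assoc, h.garside_mul_left, mul_assoc c, h.garside_mul_mid,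
      mul_assoc c, mul_assoc b, h.garside_mul_left]
    simp only [mul_assoc]
  calc _ = c * b * a * (a * b * c * a * b * a * (a * b * a)) := by simp only [pow_two, mul_assoc]
    _ = (c * b * a * c * b * c) * (a * b * c * a * b * a) := by rw [e]; simp only [mul_assoc]
    _ = _ := by rw [← h.garside_eq, pow_two]

theorem commute_sq_garside (h : IsBraidTriple a b c) :
    Commute a ((a * b * c * a * b * a) ^ 2) ∧ Commute b ((a * b * c * a * b * a) ^ 2) ∧
      Commute c ((a * b * c * a * b * a) ^ 2) := by
  have h1 := h.garside_mul_left
  have h2 := h.garside_mul_mid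
  have h3 := h.garside_mul_right
  generalize a * b * c * a * b * a = t at *
  simp only [commute_iff_eq, pow_two, ← mul_assoc]
  refine ⟨?_, ?_, ?_⟩
  · rw [← h3, mul_assoc, ← h1, mul_assoc]
  · rw [← h2, mul_assoc, ← h2, mul_assoc]
  · rw [← h1, mul_assoc, ← h3, mul_assoc]

section

variable (h : IsBraidTriple a b c) (hc : (a * b * c * a * b * a) ^ 2 = 1)
include h hc

theorem inv_last : (c * b * a ^ 2 * b * c)⁻¹ = (a * b * a) ^ 2 := by
  rw [inv_eq_iff_mul_eq_one, h.mul_sq_garside_three, hc]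

theorem conj_left : a * b ^ 2 * a⁻¹ = (c * b * a ^ 2 * b * c)⁻¹ * (b ^ 2)⁻¹ * (a ^ 2)⁻¹ := by
  rw [h.inv_last hc, h.sq_garside_three']; group

theorem conj_mid : b * a ^ 2 * b⁻¹ = (c * b * a ^ 2 * b * c)⁻¹ * (a ^ 2)⁻¹ * (b ^ 2)⁻¹ := by
  rw [h.inv_last hc, h.sq_garside_three]; group

theorem conj_last : c * (c * b * a ^ 2 * b * c)⁻¹ * c⁻¹ =
    a ^ 2 * (c * b * a ^ 2 * b * c)⁻¹⁻¹ * (c ^ 2)⁻¹ := by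
  rw [inv_inv, (h.commute_left.pow_left 2).eq, h.inv_last hc, h.sq_garside_three]
  have : c * a ^ 2 = a ^ 2 * c := (Commute.pow_left h.ac 2).eq.symm
  calc _ = c * b * a ^ 2 * b * (a ^ 2 * c) * (c ^ 2)⁻¹ := by simp only [pow_two]; group
    _ = _ := by rw [← this]; simp only [mul_assoc]

end

/-- Five elements built from a braid triple; they satisfy the pentagon relations if the square of
Garside's braid is trivial. -/
def pentagonGen (a b c : H) (i : ZMod 5) : H :=
  if i = 0 then (a * b * c ^ 2 * b * a)⁻¹ else if i = 1 then a ^ 2 else if i = 2 then b ^ 2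
  else if i = 3 then c ^ 2 else (c * b * a ^ 2 * b * c)⁻¹

section

variable (h : IsBraidTriple a b c) (hc : (a * b * c * a * b * a) ^ 2 = 1)
include h hc

theorem isPentagon_pentagonGen : IsPentagon (pentagonGen a b c) := by
  have e0 : pentagonGen a b c 0 = (a * b * c ^ 2 * b * a)⁻¹ := rfl
  have e1 : pentagonGen a b c 1 = a ^ 2 := rfl
  have e2 : pentagonGen a b c 2 = b ^ 2 := rfl
  have e3 : pentagonGen a b c 3 = c ^ 2 := rfl
  have e4 : pentagonGen a b c 4 = (c * b * a ^ 2 * b * c)⁻¹ := rfl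
  -- This makes the hypotheses symmetric under `a ↔ c`, which exchanges the pentagon elements 0 with
  -- 4 and 1 with 3.
  have hc' : (c * b * a * c * b * c) ^ 2 = 1 := by rwa [← h.garside_eq]
  have h02 : Commute (pentagonGen a b c 0) (pentagonGen a b c 2) := by
    rw [e0, e2]; exact (h.symm.commute_mid.pow_left 2).inv_right.symm
  apply IsPentagon.of_commute h02
  · rw [e1, e3]; exact Commute.pow_pow h.ac 2 2
  · rw [e2, e4]; exact (h.commute_mid.pow_left 2).inv_right
  · rw [e3, e0]; exact (h.symm.commute_left.pow_left 2).inv_right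
  · rw [e4, e1]; exact (h.commute_left.pow_left 2).inv_right.symm
  · have e : pentagonGen a b c 3 * (pentagonGen a b c 0)⁻¹ * (pentagonGen a b c 1)⁻¹ =
        a * pentagonGen a b c 0 * a⁻¹ := (h.symm.conj_last hc').symm
    have e' : pentagonGen a b c 4 * (pentagonGen a b c 2)⁻¹ * (pentagonGen a b c 1)⁻¹ =
        a * pentagonGen a b c 2 * a⁻¹ := (h.conj_left hc).symm
    rw [e, e']
    -- Conjugation by `a` realises the half twist, so the pentagon relation is a conjugate of a
    -- known commutation.
    exact (Commute.conj_iff _).2 h02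

/-- With its analogues for `b` and `c`, this matches conjugation in B_4/Z(B_4) with the half twists
on the abstract group. -/
theorem conj_pentagonGen_one (j : ZMod 5) :
    a * pentagonGen a b c j * a⁻¹ = pentagonTwist (pentagonGen a b c) 1 j := by
  have hc' : (c * b * a * c * b * c) ^ 2 = 1 := by rwa [← h.garside_eq]
  fin_cases j
  · exact h.symm.conj_last hc'
  · exact mul_inv_eq_of_eq_mul (Commute.self_pow a 2)
  · exact h.conj_left hc
  · exact mul_inv_eq_of_eq_mul (Commute.pow_right h.ac 2)
  · exact mul_inv_eq_of_eq_mul h.commute_left.inv_right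

theorem conj_pentagonGen_two (j : ZMod 5) :
    b * pentagonGen a b c j * b⁻¹ = pentagonTwist (pentagonGen a b c) 2 j := by
  have hc' : (c * b * a * c * b * c) ^ 2 = 1 := by rwa [← h.garside_eq]
  fin_cases j
  · exact mul_inv_eq_of_eq_mul h.symm.commute_mid.inv_right
  · exact h.conj_mid hc
  · exact mul_inv_eq_of_eq_mul (Commute.self_pow b 2)
  · exact h.symm.conj_mid hc'
  · exact mul_inv_eq_of_eq_mul h.commute_mid.inv_right

theorem conj_pentagonGen_three (j : ZMod 5) :
    c * pentagonGen a b c j * c⁻¹ = pentagonTwist (pentagonGen a b c) 3 j := by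
  have hc' : (c * b * a * c * b * c) ^ 2 = 1 := by rwa [← h.garside_eq]
  fin_cases j
  · exact mul_inv_eq_of_eq_mul h.symm.commute_left.inv_right
  · exact mul_inv_eq_of_eq_mul (Commute.pow_right h.ac.symm 2)
  · exact h.symm.conj_left hc'
  · exact mul_inv_eq_of_eq_mul (Commute.self_pow c 2)
  · exact h.conj_last hc

end

/-! ### Normal forms for the symmetric group. -/

/-- The normal forms of the elements of the symmetric group on four letters. -/
def normalForm (a b c : H) (i : Fin 2) (j : Fin 3) (k : Fin 4) : H :=
  ![1, a] i * ![1, b, b * a] j * ![1, c, c * b, c * b * a] k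

/-- The last factor runs through right coset representatives of the subgroup generated by `a` and
`b`. A generator multiplied on the right either permutes these (`stay`) or passes to their left as
`a` or `b` (`lift`), where the same argument applies one level down. -/
theorem exists_normalForm_mul (h : IsBraidTriple a b c) (ha : a * a = 1) (hb : b * b = 1)
    (hc : c * c = 1) (i : Fin 2) (j : Fin 3) (k : Fin 4) {s : H} (hs : s ∈ ({a, b, c} : Set H)) :
    ∃ i' j' k', normalForm a b c i j k * s = normalForm a b c i' j' k' := by
  have stepA : ∀ i : Fin 2, ∃ i' : Fin 2, ![1, a] i * a = ![1, a] i' := by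
    intro i
    fin_cases i
    · exact ⟨1, one_mul a⟩
    · exact ⟨0, ha⟩
  have stepB : ∀ (i : Fin 2) (j : Fin 3), ∀ s ∈ ({a, b} : Set H), ∃ i' j',
      ![1, a] i * ![1, b, b * a] j * s = ![1, a] i' * ![1, b, b * a] j' := by
    have lift : ∀ (i : Fin 2) (j j' : Fin 3) (s : H),
        ![1, b, b * a] j * s = a * ![1, b, b * a] j' → ∃ i' j',
          ![1, a] i * ![1, b, b * a] j * s = ![1, a] i' * ![1, b, b * a] j' := by
      intro i j j' s e
      obtain ⟨i', hi⟩ := stepA i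
      exact ⟨i', j', by rw [mul_assoc, e, ← mul_assoc, hi]⟩
    have stay : ∀ (i : Fin 2) (j j' : Fin 3) (s : H),
        ![1, b, b * a] j * s = ![1, b, b * a] j' → ∃ i' j',
          ![1, a] i * ![1, b, b * a] j * s = ![1, a] i' * ![1, b, b * a] j' :=
      fun i j j' s e => ⟨i, j', by rw [mul_assoc, e]⟩
    rintro i j s (rfl | rfl)
    · fin_cases j
      · exact lift i 0 0 _ (by simp)
      · exact stay i 1 2 _ (by simp)
      · exact stay i 2 1 _ (by simp [mul_assoc, ha])
    · fin_cases j
      · exact stay i 0 1 _ (by simp)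
      · exact stay i 1 0 _ (by simp [hb])
      · exact lift i 2 2 _ (by simp [← h.aba, ← mul_assoc])
  have lift : ∀ (k k' : Fin 4) (t : H), t ∈ ({a, b} : Set H) →
      ![1, c, c * b, c * b * a] k * s = t * ![1, c, c * b, c * b * a] k' → ∃ i' j' k',
        normalForm a b c i j k * s = normalForm a b c i' j' k' := by
    intro k k' t ht e
    obtain ⟨i', j', hij⟩ := stepB i j t ht
    exact ⟨i', j', k', by rw [normalForm, mul_assoc, e, ← mul_assoc, hij, normalForm]⟩
  have stay : ∀ (k k' : Fin 4),
      ![1, c, c * b, c * b * a] k * s = ![1, c, c * b, c * b * a] k' → ∃ i' j' k',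
        normalForm a b c i j k * s = normalForm a b c i' j' k' :=
    fun k k' e => ⟨i, j, k', by rw [normalForm, mul_assoc, e, normalForm]⟩
  rcases hs with rfl | rfl | rfl
  · fin_cases k
    · exact lift 0 0 s (by simp) (by simp)
    · exact lift 1 1 s (by simp) (by simp [h.ac])
    · exact stay 2 3 (by simp)
    · exact stay 3 2 (by simp [mul_assoc, ha])
  · fin_cases k
    · exact lift 0 0 s (by simp) (by simp)
    · exact stay 1 2 (by simp)
    · exact stay 2 1 (by simp [mul_assoc, hb])
    · refine lift 3 3 a (by simp) ?_
      calc c * s * a * s = c * (s * a * s) := by simp only [mul_assoc]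
        _ = (c * a) * s * a := by rw [← h.aba]; simp only [mul_assoc]
        _ = a * (c * s * a) := by rw [← h.ac]; simp only [mul_assoc]
  · fin_cases k
    · exact stay 0 1 (by simp)
    · exact stay 1 0 (by simp [hc])
    · refine lift 2 2 b (by simp) ?_
      calc s * b * s = b * s * b := h.bcb.symm
        _ = b * (s * b) := mul_assoc _ _ _
    · refine lift 3 3 b (by simp) ?_
      calc s * b * a * s = s * b * (a * s) := mul_assoc _ _ _
        _ = (s * b * s) * a := by rw [h.ac]; simp only [mul_assoc]
        _ = b * (s * b * a) := by rw [← h.bcb]; simp only [mul_assoc]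

end IsBraidTriple

/-! ### The action of the braid group, and its pure part modulo squares. -/

open PentagonGroup

namespace BraidGroup

theorem sigma_of_mem {n i : ℕ} (h : 1 ≤ i ∧ i < n) :
    sigma n i = PresentedGroup.of ⟨i, h⟩ := dif_pos h

theorem isBraidTriple_sigma : IsBraidTriple (sigma 4 1) (sigma 4 2) (sigma 4 3) := by
  have hb : ∀ i (h1 : 1 ≤ i) (h2 : i + 1 < 4),
      sigma 4 i * sigma 4 (i + 1) * sigma 4 i =
        sigma 4 (i + 1) * sigma 4 i * sigma 4 (i + 1) := by
    intro i h1 h2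
    rw [sigma_of_mem ⟨h1, by omega⟩, sigma_of_mem ⟨by omega, h2⟩, ← mul_inv_eq_one]
    exact PresentedGroup.one_of_mem (Or.inr ⟨⟨i, h1, by omega⟩, ⟨i + 1, by omega, h2⟩, rfl, rfl⟩)
  refine ⟨hb 1 le_rfl (by norm_num), hb 2 (by norm_num) (by norm_num), ?_⟩
  rw [sigma_of_mem ⟨by norm_num, by norm_num⟩, sigma_of_mem ⟨by norm_num, by norm_num⟩,
    ← mul_inv_eq_one]
  exact PresentedGroup.one_of_mem
    (Or.inl ⟨⟨1, by norm_num⟩, ⟨3, by norm_num⟩, by norm_num, rfl⟩)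

theorem closure_sigma : Subgroup.closure {sigma 4 1, sigma 4 2, sigma 4 3} = ⊤ := by
  rw [eq_top_iff, ← PresentedGroup.closure_range_of, Subgroup.closure_le]
  rintro _ ⟨⟨i, hi⟩, rfl⟩
  rw [← sigma_of_mem hi]
  apply Subgroup.subset_closure
  obtain ⟨h1, h2⟩ := hi
  interval_cases i <;> simp

theorem normalForm_adjSwap_eq_one (i : Fin 2) (j : Fin 3) (k : Fin 4)
    (h : IsBraidTriple.normalForm (Equiv.swap (0 : Fin 4) 1) (Equiv.swap 1 2) (Equiv.swap 2 3) i j k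
      = 1) : i = 0 ∧ j = 0 ∧ k = 0 := by
  revert i j k
  unfold IsBraidTriple.normalForm
  decide

/-- Mapping to B_4/N and S_4 at once gives both images of a braid the same normal form. For a pure
braid the permutation makes this form trivial, so the image in B_4/N is trivial too. -/
theorem ker_toPerm_le {N : Subgroup (BraidGroup 4)} [N.Normal] (h1 : sigma 4 1 ^ 2 ∈ N)
    (h2 : sigma 4 2 ^ 2 ∈ N) (h3 : sigma 4 3 ^ 2 ∈ N) : (toPerm 4).ker ≤ N := by
  set f := (QuotientGroup.mk' N).prod (toPerm 4) with hf
  have hsq : ∀ i, sigma 4 i ^ 2 ∈ N → f (sigma 4 i) * f (sigma 4 i) = 1 := by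
    intro i hi
    rw [← map_mul, ← pow_two, hf, MonoidHom.prod_apply, toPerm_sigma_sq,
      QuotientGroup.mk'_apply, (QuotientGroup.eq_one_iff _).2 hi]
    rfl
  have p1 : toPerm 4 (sigma 4 1) = Equiv.swap (0 : Fin 4) 1 := PresentedGroup.toGroup.of _
  have p2 : toPerm 4 (sigma 4 2) = Equiv.swap (1 : Fin 4) 2 := PresentedGroup.toGroup.of _
  have p3 : toPerm 4 (sigma 4 3) = Equiv.swap (2 : Fin 4) 3 := PresentedGroup.toGroup.of _
  have key : ∀ x, ∃ i j k, f x = IsBraidTriple.normalForm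
      (f (sigma 4 1)) (f (sigma 4 2)) (f (sigma 4 3)) i j k := by
    intro x
    have step := fun i j k s hs => (isBraidTriple_sigma.map f).exists_normalForm_mul
      (hsq 1 h1) (hsq 2 h2) (hsq 3 h3) i j k (s := s) hs
    have hx : x ∈ Subgroup.closure {sigma 4 1, sigma 4 2, sigma 4 3} := by
      rw [closure_sigma]; trivial
    induction hx using Subgroup.closure_induction_right with
    | one => exact ⟨0, 0, 0, by simp [IsBraidTriple.normalForm]⟩
    | mul_right x hx y hy ih =>
      obtain ⟨i, j, k, e⟩ := ih
      obtain ⟨i', j', k', e'⟩ := step i j k (f y) (by rcases hy with rfl | rfl | rfl <;> simp)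
      exact ⟨i', j', k', by rw [map_mul, e, e']⟩
    | mul_inv_cancel x hx y hy ih =>
      obtain ⟨i, j, k, e⟩ := ih
      obtain ⟨i', j', k', e'⟩ := step i j k (f y) (by rcases hy with rfl | rfl | rfl <;> simp)
      have hy' : (f y)⁻¹ = f y := by
        rw [inv_eq_iff_mul_eq_one]
        rcases hy with rfl | rfl | rfl
        exacts [hsq 1 h1, hsq 2 h2, hsq 3 h3]
      exact ⟨i', j', k', by rw [map_mul, map_inv, hy', e, e']⟩
  intro x hx
  obtain ⟨i, j, k, e⟩ := key x
  have hmap : ∀ {K : Type} [Group K] (g : _ →* K), g (f x) = IsBraidTriple.normalForm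
      (g (f (sigma 4 1))) (g (f (sigma 4 2))) (g (f (sigma 4 3))) i j k := by
    intro K _ g
    rw [e]
    fin_cases i <;> fin_cases j <;> fin_cases k <;> simp [IsBraidTriple.normalForm]
  have hp : toPerm 4 x = _ := hmap (MonoidHom.snd _ _)
  change _ = IsBraidTriple.normalForm (toPerm 4 (sigma 4 1)) (toPerm 4 (sigma 4 2))
    (toPerm 4 (sigma 4 3)) i j k at hp
  rw [MonoidHom.mem_ker.1 hx, p1, p2, p3] at hp
  obtain ⟨rfl, rfl, rfl⟩ := normalForm_adjSwap_eq_one i j k hp.symm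
  rw [← QuotientGroup.eq_one_iff]
  have : f x = 1 := by rw [e]; simp [IsBraidTriple.normalForm]
  exact congrArg Prod.fst this

/-- The action of the braid group on four strands on `PentagonGroup` by half twists. -/
def twistAction : BraidGroup 4 →* MulAut PentagonGroup :=
  PresentedGroup.toGroup (f := fun i => twist (i.1 : ℕ)) <| by
    rintro r (⟨⟨i, hi⟩, ⟨j, hj⟩, hij, rfl⟩ | ⟨⟨i, hi⟩, ⟨j, hj⟩, hij, rfl⟩) <;>
      simp only [map_mul, map_inv, FreeGroup.lift_apply_of, mul_inv_eq_one] <;> dsimp only at hij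
    · obtain rfl : i = 1 := by omega
      obtain rfl : j = 3 := by omega
      exact twist_one_comm_twist_three
    · subst hij
      obtain rfl | rfl : i = 1 ∨ i = 2 := by omega
      · exact twist_one_braid
      · exact twist_two_braid

theorem twistAction_sigma_one : twistAction (sigma 4 1) = twist 1 := PresentedGroup.toGroup.of _
theorem twistAction_sigma_two : twistAction (sigma 4 2) = twist 2 := PresentedGroup.toGroup.of _
theorem twistAction_sigma_three : twistAction (sigma 4 3) = twist 3 := PresentedGroup.toGroup.of _

theorem _root_.MulAut.conj_conj {G : Type*} [Group G] (t : MulAut G) (x : G) :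
    t * MulAut.conj x * t⁻¹ = MulAut.conj (t x) := by
  ext y; simp

theorem twistAction_pentagonGen (i : ZMod 5) :
    twistAction (IsBraidTriple.pentagonGen (sigma 4 1) (sigma 4 2) (sigma 4 3) i) =
      MulAut.conj (gen i) := by
  set a := sigma 4 1
  set b := sigma 4 2
  set c := sigma 4 3
  have ha : twistAction (a ^ 2) = MulAut.conj (gen 1) := by
    rw [map_pow, pow_two, twistAction_sigma_one, twist_mul_twist]
  have hb : twistAction (b ^ 2) = MulAut.conj (gen 2) := by
    rw [map_pow, pow_two, twistAction_sigma_two, twist_mul_twist]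
  have hc : twistAction (c ^ 2) = MulAut.conj (gen 3) := by
    rw [map_pow, pow_two, twistAction_sigma_three, twist_mul_twist]
  fin_cases i
  · change twistAction (a * b * c ^ 2 * b * a)⁻¹ = MulAut.conj (gen 0)
    -- Each factor is a conjugate of the square of a generator, so it acts as an explicit inner
    -- automorphism.
    have e : a * b * c ^ 2 * b * a =
        a * b * c ^ 2 * (a * b)⁻¹ * (a * b ^ 2 * a⁻¹) * a ^ 2 := by
      simp only [pow_two]; group
    rw [e, map_inv, inv_eq_iff_eq_inv, ← map_inv, map_mul, map_mul, map_mul, map_mul, map_mul,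
      map_mul, map_mul, map_inv, map_inv, map_mul, ha, hb, hc, twistAction_sigma_one,
      twistAction_sigma_two, MulAut.conj_conj, MulAut.conj_conj, MulAut.mul_apply,
      twist_one_twist_two_gen_three, twist_one_gen_two, ← map_mul, ← map_mul]
    congr 1
    group
  · exact ha
  · exact hb
  · exact hc
  · change twistAction (c * b * a ^ 2 * b * c)⁻¹ = MulAut.conj (gen 4)
    have e : c * b * a ^ 2 * b * c =
        c * b * a ^ 2 * (c * b)⁻¹ * (c * b ^ 2 * c⁻¹) * c ^ 2 := by
      simp only [pow_two]; group
    rw [e, map_inv, inv_eq_iff_eq_inv, ← map_inv, map_mul, map_mul, map_mul, map_mul, map_mul,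
      map_mul, map_mul, map_inv, map_inv, map_mul, ha, hb, hc, twistAction_sigma_three,
      twistAction_sigma_two, MulAut.conj_conj, MulAut.conj_conj, MulAut.mul_apply,
      twist_three_twist_two_gen_one, twist_three_gen_two, ← map_mul, ← map_mul]
    congr 1
    group

end BraidGroup

theorem PentagonGroup.conj_injective :
    Function.Injective (MulAut.conj : PentagonGroup →* MulAut PentagonGroup) := by
  rw [injective_iff_map_eq_one]
  intro z hz
  refine PentagonGroup.eq_one_of_forall_commute fun x => ?_
  have : z * x * z⁻¹ = x := DFunLike.congr_fun hz x
  exact (mul_inv_eq_iff_eq_mul.1 this).symm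

/-! ### The isomorphism with the pure modular group. -/

namespace PureModularGroupSucc

open BraidGroup

/-- The inclusion of `P_5^*` in `B_4 / Z(B_4)`. -/
def toQuotientCenter : PureModularGroupSucc 4 →* BraidGroup 4 ⧸ Subgroup.center (BraidGroup 4) :=
  QuotientGroup.map _ _ (PureBraidGroup 4).subtype le_rfl

theorem toQuotientCenter_mk (k : PureBraidGroup 4) :
    toQuotientCenter (QuotientGroup.mk k) = QuotientGroup.mk (k : BraidGroup 4) := rfl

theorem toQuotientCenter_injective : Function.Injective toQuotientCenter := by
  rw [injective_iff_map_eq_one]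
  intro p hp
  induction p using QuotientGroup.induction_on with
  | H k =>
    rw [toQuotientCenter_mk, QuotientGroup.eq_one_iff] at hp
    rwa [QuotientGroup.eq_one_iff, Subgroup.mem_subgroupOf]

/-- A central braid commutes with a braid acting as conjugation by `gen i`, so conjugation by the
image of `gen i` under `z` equals conjugation by `gen i`; faithfulness of conjugation concludes. -/
theorem twistAction_eq_one_of_mem_center {z : BraidGroup 4}
    (hz : z ∈ Subgroup.center (BraidGroup 4)) : twistAction z = 1 := by
  refine mulAut_ext fun i => PentagonGroup.conj_injective ?_
  rw [← MulAut.conj_conj, ← twistAction_pentagonGen, ← map_mul, ← map_inv, ← map_mul,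
    ← (Subgroup.mem_center_iff.1 hz _), mul_inv_cancel_right, twistAction_pentagonGen]
  rfl

/-- The morphism from `P_5^*` to the automorphisms of `PentagonGroup` induced by `twistAction`. -/
def twistAction : PureModularGroupSucc 4 →* MulAut PentagonGroup :=
  QuotientGroup.lift _ (BraidGroup.twistAction.comp (PureBraidGroup 4).subtype)
    fun _ hk => twistAction_eq_one_of_mem_center hk

/-- Representatives in `K_4` of the elements `g_i`. -/
def pentagonLift (i : ZMod 5) : PureBraidGroup 4 :=
  if i = 0 then PureBraidGroup.xTilde 4 1 5 else PureBraidGroup.xTilde 4 i.val (i.val + 1)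

theorem pentagonGenerator_eq (i : ZMod 5) :
    pentagonGenerator i = QuotientGroup.mk (pentagonLift i) := by
  fin_cases i <;> rfl

theorem coe_pentagonLift (i : ZMod 5) : (pentagonLift i : BraidGroup 4) =
    IsBraidTriple.pentagonGen (sigma 4 1) (sigma 4 2) (sigma 4 3) i := by
  fin_cases i
  · change ((PureBraidGroup.xLast 4 1 : PureBraidGroup 4) : BraidGroup 4) =
      (sigma 4 1 * sigma 4 2 * sigma 4 3 ^ 2 * sigma 4 2 * sigma 4 1)⁻¹
    rw [← isBraidTriple_sigma.prod_conj_sq]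
    simp [PureBraidGroup.xLast, PureBraidGroup.xInner, PureBraidGroup.ladder, List.Ico,
      List.range', mul_assoc]
  · change ((PureBraidGroup.xInner 4 1 2 : PureBraidGroup 4) : BraidGroup 4) = sigma 4 1 ^ 2
    simp [PureBraidGroup.xInner, PureBraidGroup.ladder]
  · change ((PureBraidGroup.xInner 4 2 3 : PureBraidGroup 4) : BraidGroup 4) = sigma 4 2 ^ 2
    simp [PureBraidGroup.xInner, PureBraidGroup.ladder]
  · change ((PureBraidGroup.xInner 4 3 4 : PureBraidGroup 4) : BraidGroup 4) = sigma 4 3 ^ 2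
    simp [PureBraidGroup.xInner, PureBraidGroup.ladder]
  · change ((PureBraidGroup.xLast 4 4 : PureBraidGroup 4) : BraidGroup 4) =
      (sigma 4 3 * sigma 4 2 * sigma 4 1 ^ 2 * sigma 4 2 * sigma 4 3)⁻¹
    simp [PureBraidGroup.xLast, PureBraidGroup.xInner, PureBraidGroup.ladder, List.Ico,
      List.range', mul_assoc, pow_two]

theorem twistAction_pentagonGenerator (i : ZMod 5) :
    twistAction (pentagonGenerator i) = MulAut.conj (gen i) := by
  rw [pentagonGenerator_eq, ← twistAction_pentagonGen, ← coe_pentagonLift]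
  rfl

theorem toQuotientCenter_pentagonGenerator (i : ZMod 5) : toQuotientCenter (pentagonGenerator i) =
    IsBraidTriple.pentagonGen (QuotientGroup.mk (sigma 4 1) : _ ⧸ Subgroup.center (BraidGroup 4))
      (QuotientGroup.mk (sigma 4 2)) (QuotientGroup.mk (sigma 4 3)) i := by
  rw [pentagonGenerator_eq, toQuotientCenter_mk, coe_pentagonLift]
  fin_cases i <;> rfl

theorem isBraidTriple_mk : IsBraidTriple
    (QuotientGroup.mk (sigma 4 1) : _ ⧸ Subgroup.center (BraidGroup 4))
    (QuotientGroup.mk (sigma 4 2)) (QuotientGroup.mk (sigma 4 3)) :=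
  isBraidTriple_sigma.map (QuotientGroup.mk' _)

theorem sq_garside_mk :
    ((QuotientGroup.mk (sigma 4 1) : _ ⧸ Subgroup.center (BraidGroup 4)) *
      QuotientGroup.mk (sigma 4 2) * QuotientGroup.mk (sigma 4 3) * QuotientGroup.mk (sigma 4 1) *
      QuotientGroup.mk (sigma 4 2) * QuotientGroup.mk (sigma 4 1)) ^ 2 = 1 := by
  refine (QuotientGroup.eq_one_iff ((sigma 4 1 * sigma 4 2 * sigma 4 3 * sigma 4 1 *
    sigma 4 2 * sigma 4 1) ^ 2)).2 ?_
  obtain ⟨h1, h2, h3⟩ := isBraidTriple_sigma.commute_sq_garside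
  rw [← Subgroup.centralizer_univ, ← Subgroup.coe_top, ← closure_sigma,
    Subgroup.centralizer_closure, Subgroup.mem_centralizer_iff]
  rintro _ (rfl | rfl | rfl)
  exacts [h1, h2, h3]

theorem isPentagon_pentagonGenerator : IsPentagon pentagonGenerator := by
  have h := isBraidTriple_mk.isPentagon_pentagonGen sq_garside_mk
  constructor
  · intro i
    apply toQuotientCenter_injective
    simp only [map_mul, toQuotientCenter_pentagonGenerator]
    exact h.comm i
  · apply toQuotientCenter_injective
    have := h.pentagon
    simp only [← toQuotientCenter_pentagonGenerator] at this
    simp only [pentagonProduct, ← map_mul, ← map_inv] at this ⊢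
    rw [this, map_one]

/-- The morphism from `PentagonGroup` to `P_5^*` which maps generators to the elements `g_i`. -/
def ofPentagonGroup : PentagonGroup →* PureModularGroupSucc 4 :=
  PentagonGroup.lift isPentagon_pentagonGenerator

theorem ofPentagonGroup_gen (i : ZMod 5) : ofPentagonGroup (gen i) = pentagonGenerator i :=
  lift_gen _ _

theorem ofPentagonGroup_injective : Function.Injective ofPentagonGroup := by
  have h : twistAction.comp ofPentagonGroup = MulAut.conj := by
    refine PresentedGroup.ext fun i => ?_
    exact (congrArg twistAction (ofPentagonGroup_gen i)).trans (twistAction_pentagonGenerator i)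
  refine Function.Injective.of_comp (f := twistAction) ?_
  rw [← MonoidHom.coe_comp, h]
  exact PentagonGroup.conj_injective

/-- Equivariance is what makes the image of the pentagon group normal in B_4/Z(B_4), not just in
P_5^*. It is checked on generators, where both sides are half twists. -/
theorem conj_toQuotientCenter_ofPentagonGroup (b : BraidGroup 4) (x : PentagonGroup) :
    (QuotientGroup.mk b : _ ⧸ Subgroup.center (BraidGroup 4)) *
      toQuotientCenter (ofPentagonGroup x) * (QuotientGroup.mk b)⁻¹ =
        toQuotientCenter (ofPentagonGroup (BraidGroup.twistAction b x)) := by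
  have hs : ∀ (s : BraidGroup 4) (t : ZMod 5), BraidGroup.twistAction s = twist t →
      (∀ j, (QuotientGroup.mk s : _ ⧸ Subgroup.center (BraidGroup 4)) *
        toQuotientCenter (pentagonGenerator j) * (QuotientGroup.mk s)⁻¹ =
          pentagonTwist (fun i => toQuotientCenter (pentagonGenerator i)) t j) →
      ∀ x, (QuotientGroup.mk s : _ ⧸ Subgroup.center (BraidGroup 4)) *
        toQuotientCenter (ofPentagonGroup x) * (QuotientGroup.mk s)⁻¹ =
          toQuotientCenter (ofPentagonGroup (BraidGroup.twistAction s x)) := by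
    intro s t hst hconj x
    set f := toQuotientCenter.comp ofPentagonGroup with hf
    have hfg : ∀ i, f (gen i) = toQuotientCenter (pentagonGenerator i) := fun i =>
      congrArg toQuotientCenter (ofPentagonGroup_gen i)
    suffices (MulAut.conj (QuotientGroup.mk s : _ ⧸ Subgroup.center (BraidGroup 4))).toMonoidHom.comp
        f = f.comp (BraidGroup.twistAction s).toMonoidHom from DFunLike.congr_fun this x
    refine PresentedGroup.ext fun j => ?_
    change QuotientGroup.mk s * f (gen j) * (QuotientGroup.mk s)⁻¹ =
      f (BraidGroup.twistAction s (gen j))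
    rw [hst, hfg, hconj, twist_gen]
    unfold pentagonTwist
    split_ifs <;> simp only [map_mul, map_inv, hfg]
  have hb : b ∈ Subgroup.closure {sigma 4 1, sigma 4 2, sigma 4 3} := by
    rw [closure_sigma]; trivial
  induction hb using Subgroup.closure_induction generalizing x with
  | mem s hmem =>
    have h := isBraidTriple_mk
    have hc := sq_garside_mk
    rcases hmem with rfl | rfl | rfl
    · refine hs _ 1 twistAction_sigma_one (fun j => ?_) x
      simp only [toQuotientCenter_pentagonGenerator]
      exact h.conj_pentagonGen_one hc j
    · refine hs _ 2 twistAction_sigma_two (fun j => ?_) x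
      simp only [toQuotientCenter_pentagonGenerator]
      exact h.conj_pentagonGen_two hc j
    · refine hs _ 3 twistAction_sigma_three (fun j => ?_) x
      simp only [toQuotientCenter_pentagonGenerator]
      exact h.conj_pentagonGen_three hc j
  | one => simp
  | mul a b _ _ iha ihb =>
    rw [map_mul, MulAut.mul_apply, ← iha, ← ihb, QuotientGroup.mk_mul]
    group
  | inv a _ ih =>
    have := ih ((BraidGroup.twistAction a)⁻¹ x)
    rw [MulAut.apply_inv_self] at this
    rw [map_inv, ← this, QuotientGroup.mk_inv]
    group

theorem ofPentagonGroup_surjective : Function.Surjective ofPentagonGroup := by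
  set N := (toQuotientCenter.comp ofPentagonGroup).range.comap
    (QuotientGroup.mk' (Subgroup.center (BraidGroup 4))) with hN
  have hnormal : N.Normal := by
    constructor
    rintro n ⟨x, hx⟩ b
    refine ⟨BraidGroup.twistAction b x, ?_⟩
    refine (conj_toQuotientCenter_ofPentagonGroup b x).symm.trans ?_
    change toQuotientCenter (ofPentagonGroup x) = _ at hx
    rw [hx]
    rfl
  have hmem : ∀ i, (pentagonLift i : BraidGroup 4) ∈ N := fun i =>
    ⟨gen i, by
      rw [MonoidHom.comp_apply, ofPentagonGroup_gen, pentagonGenerator_eq]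
      rfl⟩
  simp only [coe_pentagonLift] at hmem
  -- The elements with indices 1, 2, 3 are the squares of the three Artin generators.
  have hK : (toPerm 4).ker ≤ N := ker_toPerm_le (hmem 1) (hmem 2) (hmem 3)
  intro p
  induction p using QuotientGroup.induction_on with
  | H k =>
    obtain ⟨x, hx⟩ := hK k.2
    exact ⟨x, toQuotientCenter_injective hx⟩

end PureModularGroupSucc

theorem mainTheorem11 :
    ∃ φ : PresentedGroup pentagonRelations ≃* PureModularGroupSucc 4,
      ∀ i : ZMod 5, φ (PresentedGroup.of i) = pentagonGenerator i := by
  exact ⟨MulEquiv.ofBijective PureModularGroupSucc.ofPentagonGroup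
    ⟨PureModularGroupSucc.ofPentagonGroup_injective,
      PureModularGroupSucc.ofPentagonGroup_surjective⟩,
    PureModularGroupSucc.ofPentagonGroup_gen⟩
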